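/- Approximate universality of $\mathcal{U}\Pi_a$ for isometries. Base types are generated by $b ::= 0 \mid 1 \mid b+b \mid b\times b$. The combinators $c : b_1\leftrightarrow b_2$ of $\mathcal{U}\Pi$ are generated, under sequential composition $c_1 ; c_2$, sum $c_1+c_2$ and product $c_1\times c_2$, by $\mathit{id}: b\leftrightarrow b$; $\mathit{swap}^+ : b_1+b_2\leftrightarrow b_2+b_1$ and $\mathit{swap}^\times : b_1\times b_2\leftrightarrow b_2\times b_1$; $\mathit{unit}^+ : b+0\leftrightarrow b$, $\mathit{assoc}^+ : (b_1+b_2)+b_3\leftrightarrow b_1+(b_2+b_3)$, $\mathit{unit}^\times : b\times 1\leftrightarrow b$, $\mathit{assoc}^\times : (b_1\times b_2)\times b_3\leftrightarrow b_1\times(b_2\times b_3)$, $\mathit{distrib} : b_1\times(b_2+b_3)\leftrightarrow (b_1\times b_2)+(b_1\times b_3)$, $\mathit{distribo} : b\times 0\leftrightarrow 0$, and formal inverses of these six; $\mathit{phase}_\varphi : 1\leftrightarrow 1$ for every $\varphi\in\mathbb{C}$ with $|\varphi|=1$; and $\mathit{hadamard} : 1+1\leftrightarrow 1+1$. The semantics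 $[\![b]\!]$ of a type is the finite-dimensional Hilbert space given by $[\![0]\!]=0$, $[\![1]\!]=\mathbb{C}$, $[\![b+b']\!]=[\![b]\!]\oplus[\![b']\!]$, $[\![b\times b']\!]=[\![b]\!]\otimes[\![b']\!]$, and the semantics $[\![c]\!]:[\![b_1]\!]\to[\![b_2]\!]$ of a combinator is the unitary obtained by reading the structural combinators as the canonical isomorphisms, $;$, $+$, $\times$ as composition, $\oplus$, $\otimes$, $\mathit{phase}_\varphi$ as multiplication by $\varphi$, and $\mathit{hadamard}$ as $\frac{1}{\sqrt2}\begin{pmatrix}1&1\\1&-1\end{pmatrix}$. A $\mathcal{U}\Pi_a$ combinator $v : b_1\rightarrowtail b_2$ is a term $\mathit{lift}\,u$ where $u : b_1+b_3\leftrightarrow b_2$ is a $\mathcal{U}\Pi$ combinator, for some type $b_3$ (the heap). Its semantics is the class of $[\![u]\!]$ modulo identifying a unitary $f : A\oplus H\to B$ with $f\circ(\mathrm{id}_A\oplus h) : A\oplus H'\to B$ for every unitary $h : H'\to H$; this class is identified with the isometry $[\![v]\!]=[\![u]\!]\circ\iota_1 : [\![b_1]\!]\to[\![b_2]\!]$,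 where $\iota_1 : [\![b_1]\!]\to[\![b_1]\!]\oplus[\![b_3]\!]$ is the first injection. Write $\mathit{Qbit}=1+1$, and $\mathit{Qbit}^n$ for its $n$-fold product ($\mathit{Qbit}^0=1$), so that $[\![\mathit{Qbit}^n]\!]\cong\mathbb{C}^{2^n}$ through the computational basis in its usual (lexicographic) order. Theorem. For all natural numbers $m,n$, every $2^n\times 2^m$ complex matrix $V$ with $V^\dagger V=I$ (an isometry $\mathbb{C}^{2^m}\to\mathbb{C}^{2^n}$) and every real $\delta>0$, there is a $\mathcal{U}\Pi_a$ combinator $v : \mathit{Qbit}^m\rightarrowtail\mathit{Qbit}^n$ such that $\lVert V-[\![v]\!]\rVert<\delta$ in the operator norm. -/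

import Mathlib

open scoped Matrix Kronecker Matrix.Norms.L2Operator

noncomputable section

namespace UPi

/-! ## Syntax and typing -/

/-- Base types `b ::= 0 | 1 | b + b | b × b`. -/
inductive Ty : Type
  | zero : Ty
  | one : Ty
  | sum : Ty → Ty → Ty
  | prod : Ty → Ty → Ty

/-- Well-typed `UΠ` combinators of type `b₁ ↔ b₂`: the combinators of `Π` together with
`phase` (one for every complex number of modulus one) and `hadamard`. -/
inductive Comb : Ty → Ty → Type
  | id (b : Ty) : Comb b b
  | swapSum (b₁ b₂ : Ty) : Comb (.sum b₁ b₂) (.sum b₂ b₁)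
  | unitSum (b : Ty) : Comb (.sum b .zero) b
  | unitiSum (b : Ty) : Comb b (.sum b .zero)
  | assocSum (b₁ b₂ b₃ : Ty) : Comb (.sum (.sum b₁ b₂) b₃) (.sum b₁ (.sum b₂ b₃))
  | associSum (b₁ b₂ b₃ : Ty) : Comb (.sum b₁ (.sum b₂ b₃)) (.sum (.sum b₁ b₂) b₃)
  | swapProd (b₁ b₂ : Ty) : Comb (.prod b₁ b₂) (.prod b₂ b₁)
  | unitProd (b : Ty) : Comb (.prod b .one) b
  | unitiProd (b : Ty) : Comb b (.prod b .one)
  | assocProd (b₁ b₂ b₃ : Ty) : Comb (.prod (.prod b₁ b₂) b₃) (.prod b₁ (.prod b₂ b₃))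
  | associProd (b₁ b₂ b₃ : Ty) : Comb (.prod b₁ (.prod b₂ b₃)) (.prod (.prod b₁ b₂) b₃)
  | distrib (b₁ b₂ b₃ : Ty) :
      Comb (.prod b₁ (.sum b₂ b₃)) (.sum (.prod b₁ b₂) (.prod b₁ b₃))
  | distribi (b₁ b₂ b₃ : Ty) :
      Comb (.sum (.prod b₁ b₂) (.prod b₁ b₃)) (.prod b₁ (.sum b₂ b₃))
  | distribo (b : Ty) : Comb (.prod b .zero) .zero
  | distriboi (b : Ty) : Comb .zero (.prod b .zero)
  | phase (φ : Circle) : Comb .one .one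
  | hadamard : Comb (.sum .one .one) (.sum .one .one)
  | seq {b₁ b₂ b₃ : Ty} : Comb b₁ b₂ → Comb b₂ b₃ → Comb b₁ b₃
  | sum {b₁ b₂ b₃ b₄ : Ty} : Comb b₁ b₃ → Comb b₂ b₄ → Comb (.sum b₁ b₂) (.sum b₃ b₄)
  | prod {b₁ b₂ b₃ b₄ : Ty} : Comb b₁ b₃ → Comb b₂ b₄ → Comb (.prod b₁ b₂) (.prod b₃ b₄)

/-- Well-typed `UΠₐ` combinators of type `b₁ ↣ b₂`. The only primitive is `lift u`, where `u` is
a `UΠ` combinator `b₁ + b₃ ↔ b₂` with a hidden heap of type `b₃`; all the other combinators of the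
metalanguage are abbreviations for particular terms `lift u`. -/
inductive CombA : Ty → Ty → Type
  | lift {b₁ b₂ b₃ : Ty} (u : Comb (.sum b₁ b₃) b₂) : CombA b₁ b₂

/-- The qubit type `1 + 1`. -/
abbrev Qbit : Ty := .sum .one .one

/-- The `n`-fold product of the qubit type with itself; the empty product is the unit type. -/
abbrev qbits : ℕ → Ty
  | 0 => .one
  | 1 => Qbit
  | n + 2 => .prod Qbit (qbits (n + 1))

/-! ## Finite-dimensional Hilbert spaces with unitaries, and with isometries

A finite type `A` stands for the Hilbert space `ℂ^A`, and linear maps `ℂ^A → ℂ^B` are matrices with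
rows indexed by `B` and columns by `A`. Then `ℂ^A ⊕ ℂ^B = ℂ^(A ⊕ B)` and
`ℂ^A ⊗ ℂ^B = ℂ^(A × B)`. -/

/-- Unitaries `ℂ^A → ℂ^B`. -/
@[ext]
structure Unitary (A B : Type) [Fintype A] [DecidableEq A] [Fintype B] [DecidableEq B] where
  /-- The matrix of the map. -/
  mat : Matrix B A ℂ
  star_mul : matᴴ * mat = 1
  mul_star : mat * matᴴ = 1

/-- Isometries `ℂ^A → ℂ^B`. -/
@[ext]
structure Isom (A B : Type) [Fintype A] [DecidableEq A] [Fintype B] [DecidableEq B] where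
  /-- The matrix of the map. -/
  mat : Matrix B A ℂ
  star_mul : matᴴ * mat = 1

section

variable {A B C D : Type} [Fintype A] [DecidableEq A] [Fintype B] [DecidableEq B]
  [Fintype C] [DecidableEq C] [Fintype D] [DecidableEq D]

/-- The unitary that sends the basis vector `a` to the basis vector `e a`. -/
def Unitary.ofEquiv (e : A ≃ B) : Unitary A B where
  mat := Matrix.of fun b a => if b = e a then 1 else 0
  star_mul := by
    ext i j
    simp [Matrix.mul_apply, Matrix.one_apply, eq_comm (a := i)]
  mul_star := by
    ext i j
    simp only [Matrix.mul_apply, Matrix.one_apply, Matrix.conjTranspose_apply, Matrix.of_apply]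
    rw [← e.symm.sum_comp]
    simp

/-- The identity. -/
def Unitary.id (X : Type) [Fintype X] [DecidableEq X] : Unitary X X where
  mat := 1
  star_mul := by simp
  mul_star := by simp

/-- The composite `g ∘ f`. -/
def Unitary.comp (g : Unitary B C) (f : Unitary A B) : Unitary A C where
  mat := g.mat * f.mat
  star_mul := by
    rw [Matrix.conjTranspose_mul, Matrix.mul_assoc, ← Matrix.mul_assoc _ g.mat, g.star_mul,
      Matrix.one_mul, f.star_mul]
  mul_star := by
    rw [Matrix.conjTranspose_mul, Matrix.mul_assoc, ← Matrix.mul_assoc f.mat, f.mul_star,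
      Matrix.one_mul, g.mul_star]

/-- The direct sum `f ⊕ g`. -/
def Unitary.dsum (f : Unitary A C) (g : Unitary B D) : Unitary (A ⊕ B) (C ⊕ D) where
  mat := Matrix.fromBlocks f.mat 0 0 g.mat
  star_mul := by
    simp [Matrix.fromBlocks_conjTranspose, Matrix.fromBlocks_multiply, f.star_mul, g.star_mul]
  mul_star := by
    simp [Matrix.fromBlocks_conjTranspose, Matrix.fromBlocks_multiply, f.mul_star, g.mul_star]

/-- The tensor product `f ⊗ g`. -/
def Unitary.tensor (f : Unitary A C) (g : Unitary B D) : Unitary (A × B) (C × D) where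
  mat := f.mat ⊗ₖ g.mat
  star_mul := by
    rw [Matrix.conjTranspose_kronecker, ← Matrix.mul_kronecker_mul, f.star_mul, g.star_mul,
      Matrix.one_kronecker_one]
  mul_star := by
    rw [Matrix.conjTranspose_kronecker, ← Matrix.mul_kronecker_mul, f.mul_star, g.mul_star,
      Matrix.one_kronecker_one]

/-- The `1 × 1` unitary matrix `(φ)`. -/
def Unitary.phase (φ : Circle) : Unitary Unit Unit where
  mat := Matrix.of fun _ _ => (φ : ℂ)
  star_mul := by
    ext i j
    simp [Matrix.mul_apply, ← Complex.normSq_eq_conj_mul_self]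
  mul_star := by
    ext i j
    simp [Matrix.mul_apply, Complex.mul_conj]

/-- The Hadamard matrix with rows `(1, 1)` and `(1, -1)`, divided by `√2`. -/
def hadamardMat : Matrix (Unit ⊕ Unit) (Unit ⊕ Unit) ℂ :=
  ((1 : ℂ) / ((√2 : ℝ) : ℂ)) • Matrix.fromBlocks 1 1 1 (-1)

theorem hadamardMat_conjTranspose : hadamardMatᴴ = hadamardMat := by
  simp [hadamardMat, Matrix.conjTranspose_smul, Matrix.fromBlocks_conjTranspose]

theorem hadamardMat_mul_self : hadamardMat * hadamardMat = 1 := by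
  have h : ((1 : ℂ) / ((√2 : ℝ) : ℂ)) * ((1 : ℂ) / ((√2 : ℝ) : ℂ)) = 1 / 2 := by
    rw [div_mul_div_comm, ← Complex.ofReal_mul, Real.mul_self_sqrt (by norm_num)]
    norm_num
  rw [hadamardMat, Matrix.smul_mul, Matrix.mul_smul, smul_smul, h, Matrix.fromBlocks_multiply,
    Matrix.fromBlocks_smul, ← Matrix.fromBlocks_one]
  congr 1 <;> ext i j <;> simp <;> norm_num

/-- The Hadamard gate. -/
def Unitary.hadamard : Unitary (Unit ⊕ Unit) (Unit ⊕ Unit) where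
  mat := hadamardMat
  star_mul := by rw [hadamardMat_conjTranspose, hadamardMat_mul_self]
  mul_star := by rw [hadamardMat_conjTranspose, hadamardMat_mul_self]

/-- The composite `g ∘ f` of isometries. -/
def Isom.comp (g : Isom B C) (f : Isom A B) : Isom A C where
  mat := g.mat * f.mat
  star_mul := by
    rw [Matrix.conjTranspose_mul, Matrix.mul_assoc, ← Matrix.mul_assoc _ g.mat, g.star_mul,
      Matrix.one_mul, f.star_mul]

/-- Unitaries are isometries. -/
def Unitary.toIsom (f : Unitary A B) : Isom A B := ⟨f.mat, f.star_mul⟩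

/-- The first injection `ℂ^X → ℂ^X ⊕ ℂ^Y`. -/
def Isom.inl (X Y : Type) [Fintype X] [DecidableEq X] [Fintype Y] [DecidableEq Y] :
    Isom X (X ⊕ Y) where
  mat := Matrix.fromRows 1 0
  star_mul := by
    simp [Matrix.conjTranspose_fromRows_eq_fromCols_conjTranspose, Matrix.fromCols_mul_fromRows]

/-! ## Adding a heap -/

/-- A unitary `ℂ^A ⊕ ℂ^H → ℂ^B` together with its heap `ℂ^H`. -/
structure HeapMor (A B : Type) [Fintype A] [DecidableEq A] [Fintype B] [DecidableEq B] where
  /-- The index set of the heap. -/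
  Heap : Type
  [fintypeHeap : Fintype Heap]
  [decEqHeap : DecidableEq Heap]
  /-- The underlying unitary. -/
  mor : Unitary (A ⊕ Heap) B

attribute [instance] HeapMor.fintypeHeap HeapMor.decEqHeap

/-- The relation that identifies `f : A ⊕ H → B` with `f ∘ (id ⊕ h) : A ⊕ H' → B` for every unitary
mediator `h : H' → H`. -/
def HeapMor.Rel (f g : HeapMor A B) : Prop :=
  ∃ h : Unitary g.Heap f.Heap, g.mor = f.mor.comp ((Unitary.id A).dsum h)

variable (A B) in
/-- Morphisms `ℂ^A → ℂ^B` of the category obtained from unitaries by adding heaps: equivalence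
classes of unitaries `ℂ^A ⊕ ℂ^H → ℂ^B` under the equivalence relation generated by mediators. -/
def RHom : Type 1 := Quot (HeapMor.Rel (A := A) (B := B))

/-- The canonical identification of the morphisms of the heap category with isometries, given on
the class of `f : ℂ^A ⊕ ℂ^H → ℂ^B` by precomposition with the first injection. -/
def RHom.toIsom : RHom A B → Isom A B :=
  Quot.lift (fun f => f.mor.toIsom.comp (Isom.inl A f.Heap)) (by
    rintro f g ⟨h, hg⟩
    ext1
    simp [Isom.comp, Isom.inl, Unitary.toIsom, hg, Unitary.comp, Unitary.dsum, Unitary.id,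
      Matrix.mul_assoc, Matrix.fromBlocks_mul_fromRows])

end

/-! ## Semantics -/

/-- The index set of the computational basis of the Hilbert space that interprets a type. -/
abbrev Ty.Basis : Ty → Type
  | .zero => Empty
  | .one => Unit
  | .sum a b => a.Basis ⊕ b.Basis
  | .prod a b => a.Basis × b.Basis

instance Ty.instFintypeBasis : (b : Ty) → Fintype b.Basis
  | .zero => inferInstanceAs (Fintype Empty)
  | .one => inferInstanceAs (Fintype Unit)
  | .sum a b =>
    let _ := Ty.instFintypeBasis a
    let _ := Ty.instFintypeBasis b
    inferInstanceAs (Fintype (a.Basis ⊕ b.Basis))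
  | .prod a b =>
    let _ := Ty.instFintypeBasis a
    let _ := Ty.instFintypeBasis b
    inferInstanceAs (Fintype (a.Basis × b.Basis))

instance Ty.instDecidableEqBasis : (b : Ty) → DecidableEq b.Basis
  | .zero => inferInstanceAs (DecidableEq Empty)
  | .one => inferInstanceAs (DecidableEq Unit)
  | .sum a b =>
    let _ := Ty.instDecidableEqBasis a
    let _ := Ty.instDecidableEqBasis b
    inferInstanceAs (DecidableEq (a.Basis ⊕ b.Basis))
  | .prod a b =>
    let _ := Ty.instDecidableEqBasis a
    let _ := Ty.instDecidableEqBasis b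
    inferInstanceAs (DecidableEq (a.Basis × b.Basis))

/-- The unitary denoted by a `UΠ` combinator. -/
def Comb.sem : {b₁ b₂ : Ty} → Comb b₁ b₂ → Unitary b₁.Basis b₂.Basis
  | _, _, .id b => Unitary.id b.Basis
  | _, _, .swapSum b₁ b₂ => Unitary.ofEquiv (Equiv.sumComm b₁.Basis b₂.Basis)
  | _, _, .unitSum b => Unitary.ofEquiv (Equiv.sumEmpty b.Basis Empty)
  | _, _, .unitiSum b => Unitary.ofEquiv (Equiv.sumEmpty b.Basis Empty).symm
  | _, _, .assocSum b₁ b₂ b₃ => Unitary.ofEquiv (Equiv.sumAssoc b₁.Basis b₂.Basis b₃.Basis)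
  | _, _, .associSum b₁ b₂ b₃ =>
      Unitary.ofEquiv (Equiv.sumAssoc b₁.Basis b₂.Basis b₃.Basis).symm
  | _, _, .swapProd b₁ b₂ => Unitary.ofEquiv (Equiv.prodComm b₁.Basis b₂.Basis)
  | _, _, .unitProd b => Unitary.ofEquiv (Equiv.prodUnique b.Basis Unit)
  | _, _, .unitiProd b => Unitary.ofEquiv (Equiv.prodUnique b.Basis Unit).symm
  | _, _, .assocProd b₁ b₂ b₃ => Unitary.ofEquiv (Equiv.prodAssoc b₁.Basis b₂.Basis b₃.Basis)
  | _, _, .associProd b₁ b₂ b₃ =>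
      Unitary.ofEquiv (Equiv.prodAssoc b₁.Basis b₂.Basis b₃.Basis).symm
  | _, _, .distrib b₁ b₂ b₃ =>
      Unitary.ofEquiv (Equiv.prodSumDistrib b₁.Basis b₂.Basis b₃.Basis)
  | _, _, .distribi b₁ b₂ b₃ =>
      Unitary.ofEquiv (Equiv.prodSumDistrib b₁.Basis b₂.Basis b₃.Basis).symm
  | _, _, .distribo b => Unitary.ofEquiv (Equiv.prodEmpty b.Basis)
  | _, _, .distriboi b => Unitary.ofEquiv (Equiv.prodEmpty b.Basis).symm
  | _, _, .phase φ => Unitary.phase φ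
  | _, _, .hadamard => Unitary.hadamard
  | _, _, .seq c₁ c₂ => c₂.sem.comp c₁.sem
  | _, _, .sum c₁ c₂ => c₁.sem.dsum c₂.sem
  | _, _, .prod c₁ c₂ => c₁.sem.tensor c₂.sem

/-- The morphism denoted by a `UΠₐ` combinator: `lift u` denotes the class of the unitary denoted
by `u`. -/
def CombA.sem {b₁ b₂ : Ty} : CombA b₁ b₂ → RHom b₁.Basis b₂.Basis
  | .lift (b₃ := b₃) u => Quot.mk _ { Heap := b₃.Basis, mor := u.sem }

/-! ## Matrices in the computational basis -/

/-- The dimension of the Hilbert space that interprets a type. -/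
def Ty.dim : Ty → ℕ
  | .zero => 0
  | .one => 1
  | .sum a b => a.dim + b.dim
  | .prod a b => a.dim * b.dim

/-- The standard ordering of the computational basis: the left summand comes before the right one,
and pairs are ordered lexicographically. -/
def Ty.enum : (b : Ty) → b.Basis ≃ Fin b.dim
  | .zero => finZeroEquiv.symm
  | .one => finOneEquiv.symm
  | .sum a b => (Equiv.sumCongr a.enum b.enum).trans finSumFinEquiv
  | .prod a b => (Equiv.prodCongr a.enum b.enum).trans finProdFinEquiv

theorem dim_qbits : ∀ n : ℕ, (qbits n).dim = 2 ^ n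
  | 0 => rfl
  | 1 => rfl
  | n + 2 => by
    have h := dim_qbits (n + 1)
    have h2 : (qbits (n + 2)).dim = 2 * (qbits (n + 1)).dim := rfl
    rw [h2, h]
    ring

/-- The computational basis of `n` qubits in its usual order, so that the basis vector
`|x₁ x₂ … xₙ⟩` has the number with binary digits `x₁ x₂ … xₙ` (`x₁` the most significant). -/
def qbitsEnum (n : ℕ) : (qbits n).Basis ≃ Fin (2 ^ n) :=
  (qbits n).enum.trans (finCongr (dim_qbits n))

/-- The `2 ^ n × 2 ^ m` matrix, in the computational bases, of the isometry denoted by a `UΠₐ`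
combinator from `m` qubits to `n` qubits. -/
def CombA.matrix {m n : ℕ} (v : CombA (qbits m) (qbits n)) :
    Matrix (Fin (2 ^ n)) (Fin (2 ^ m)) ℂ :=
  v.sem.toIsom.mat.submatrix (qbitsEnum n).symm (qbitsEnum m).symm

end UPi

end

/-! Since every phase is a primitive, universality is exact: each isometry is denoted by some
combinator, and `δ` plays no role beyond being positive. Up to combinators every type is a `k`-fold
sum of `1`, so it suffices to treat unitaries `U` on `ℂ^k`, by induction on `k`. Phases and
Hadamards prepare any vector of `ℂ²` from `r e₁` with `r ≥ 0` (`exists_qbit_prepare`), and two-level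
steps then prepare any vector of `ℂ^k` (`exists_prepare`). If `c` prepares the first column of `U`,
then `c† U` sends `e₁` to `r e₁`; this forces `r = 1` and `c† U = 1 ⊕ g`, and the induction
hypothesis applies to `g` (`exists_sem_eq_ofNat`). An isometry is the restriction of a unitary whose
heap has the missing dimension (`Isom.exists_unitary`). -/

namespace UPi

/-! ## Unitaries acting on vectors -/

namespace Unitary

variable {A B C D : Type} [Fintype A] [DecidableEq A] [Fintype B] [DecidableEq B]
  [Fintype C] [DecidableEq C] [Fintype D] [DecidableEq D]

/-- The adjoint of a unitary. -/
def adjoint (f : Unitary A B) : Unitary B A where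
  mat := f.matᴴ
  star_mul := by rw [Matrix.conjTranspose_conjTranspose, f.mul_star]
  mul_star := by rw [Matrix.conjTranspose_conjTranspose, f.star_mul]

theorem comp_assoc (h : Unitary C D) (g : Unitary B C) (f : Unitary A B) :
    (h.comp g).comp f = h.comp (g.comp f) :=
  Unitary.ext (Matrix.mul_assoc _ _ _)

theorem adjoint_comp (f : Unitary A B) : f.adjoint.comp f = Unitary.id A :=
  Unitary.ext f.star_mul

theorem comp_adjoint (f : Unitary A B) : f.comp f.adjoint = Unitary.id B :=
  Unitary.ext f.mul_star

theorem id_comp (f : Unitary A B) : (Unitary.id B).comp f = f :=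
  Unitary.ext (Matrix.one_mul _)

theorem comp_id (f : Unitary A B) : f.comp (Unitary.id A) = f :=
  Unitary.ext (Matrix.mul_one _)

theorem comp_adjoint_comp (g : Unitary B C) (f : Unitary A C) :
    g.comp (g.adjoint.comp f) = f := by
  rw [← comp_assoc, comp_adjoint, id_comp]

theorem comp_comp_adjoint (g : Unitary A B) (f : Unitary A C) :
    (f.comp g.adjoint).comp g = f := by
  rw [comp_assoc, adjoint_comp, comp_id]

/-- The image of a vector under a unitary. -/
def apply (f : Unitary A B) (v : A → ℂ) : B → ℂ := f.mat *ᵥ v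

theorem comp_apply (g : Unitary B C) (f : Unitary A B) (v : A → ℂ) :
    (g.comp f).apply v = g.apply (f.apply v) :=
  (Matrix.mulVec_mulVec _ _ _).symm

theorem id_apply (v : A → ℂ) : (Unitary.id A).apply v = v :=
  Matrix.one_mulVec _

theorem dsum_apply (f : Unitary A C) (g : Unitary B D) (v : A → ℂ) (w : B → ℂ) :
    (f.dsum g).apply (Sum.elim v w) = Sum.elim (f.apply v) (g.apply w) := by
  simp [apply, dsum, Matrix.fromBlocks_mulVec]

theorem ofEquiv_apply (e : A ≃ B) (v : A → ℂ) : (Unitary.ofEquiv e).apply v = v ∘ e.symm := by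
  ext b
  simp only [apply, ofEquiv, Matrix.mulVec, dotProduct, Matrix.of_apply, Function.comp_apply]
  rw [← e.symm.sum_comp]
  simp

theorem phase_apply (φ : Circle) (a : ℂ) :
    (Unitary.phase φ).apply (fun _ => a) = fun _ => φ * a := by
  ext
  simp [apply, phase, Matrix.mulVec, dotProduct]

theorem hadamard_apply (a b : ℂ) :
    Unitary.hadamard.apply (Sum.elim (fun _ => a) fun _ => b) =
      Sum.elim (fun _ => 1 / ((√2 : ℝ) : ℂ) * (a + b)) fun _ => 1 / ((√2 : ℝ) : ℂ) * (a - b) := by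
  ext (x | x) <;>
    simp [apply, hadamard, hadamardMat, Matrix.mulVec, dotProduct, Matrix.fromBlocks_apply₁₁] <;>
    ring

/-- The inductive step of vector preparation: `g` acts on the first two coordinates, then `f` on all
but the first. -/
theorem sumAssoc_conj_apply {g : Unitary (Unit ⊕ Unit) (Unit ⊕ Unit)}
    {f : Unitary (Unit ⊕ A) (Unit ⊕ A)} {a b p q : ℂ} {u : A → ℂ}
    {w : Unit ⊕ A → ℂ}
    (hg : g.apply (Sum.elim (fun _ => p) fun _ => q) = Sum.elim (fun _ => a) fun _ => b)
    (hf : f.apply (Sum.elim (fun _ => b) u) = w) :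
    ((((Unitary.id Unit).dsum f).comp (Unitary.ofEquiv (Equiv.sumAssoc Unit Unit A))).comp
      ((g.dsum (Unitary.id A)).comp (Unitary.ofEquiv (Equiv.sumAssoc Unit Unit A).symm))).apply
      (Sum.elim (fun _ => p) (Sum.elim (fun _ => q) u)) = Sum.elim (fun _ => a) w := by
  have h1 : (Sum.elim (fun _ => p) (Sum.elim (fun _ => q) u)) ∘ Equiv.sumAssoc Unit Unit A =
      Sum.elim (Sum.elim (fun _ => p) fun _ => q) u := by
    ext ((_ | _) | _) <;> rfl
  have h2 : (Sum.elim (Sum.elim (fun _ => a) fun _ => b) u) ∘ (Equiv.sumAssoc Unit Unit A).symm =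
      Sum.elim (fun _ => a) (Sum.elim (fun _ => b) u) := by
    ext (_ | (_ | _)) <;> rfl
  rw [comp_apply, comp_apply, comp_apply, ofEquiv_apply (Equiv.symm _), Equiv.symm_symm, h1,
    dsum_apply, hg, id_apply, ofEquiv_apply, h2, dsum_apply, hf, id_apply]

/-- Both cardinalities are traces, of `f†f` and of `ff†`. -/
theorem card_eq (f : Unitary A B) : Fintype.card A = Fintype.card B := by
  have h := Matrix.trace_mul_comm f.matᴴ f.mat
  rw [f.star_mul, f.mul_star, Matrix.trace_one, Matrix.trace_one] at h
  exact_mod_cast h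

/-- A unitary that sends the first basis vector to a nonnegative multiple of itself is the direct
sum of the identity and a unitary. -/
theorem exists_eq_dsum (f : Unitary (Unit ⊕ A) (Unit ⊕ A)) (r : ℝ) (hr : 0 ≤ r)
    (h : ∀ x, f.mat x (Sum.inl ()) = if x = Sum.inl () then (r : ℂ) else 0) :
    ∃ g : Unitary A A, f = (Unitary.id Unit).dsum g := by
  -- The first column has norm one, so `r² = 1`, and `0 ≤ r` excludes `-1`.
  have hr1 : r = 1 := by
    have h1 := congrFun (congrFun f.star_mul (Sum.inl ())) (Sum.inl ())
    simp only [Matrix.mul_apply, Matrix.conjTranspose_apply, h] at h1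
    simp at h1
    have h2 : r * r = 1 := by exact_mod_cast h1
    nlinarith
  subst hr1
  -- The first column is now `e₁`, so orthonormality of the columns determines the first row.
  have hrow : ∀ x, f.mat (Sum.inl ()) x = if x = Sum.inl () then 1 else 0 := by
    intro x
    have h1 := congrFun (congrFun f.star_mul (Sum.inl ())) x
    simp only [Matrix.mul_apply, Matrix.conjTranspose_apply, h, Matrix.one_apply] at h1
    simpa [eq_comm] using h1
  have hf : f.mat = Matrix.fromBlocks 1 0 0 f.mat.toBlocks₂₂ := by
    ext (x | x) (y | y) <;> simp [h, hrow, Matrix.toBlocks₂₂]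
  have h1 := f.star_mul
  have h2 := f.mul_star
  rw [hf, Matrix.fromBlocks_conjTranspose, Matrix.fromBlocks_multiply,
    ← Matrix.fromBlocks_one, Matrix.fromBlocks_inj] at h1 h2
  exact ⟨⟨f.mat.toBlocks₂₂, by simpa using h1.2.2.2, by simpa using h2.2.2.2⟩, Unitary.ext hf⟩

end Unitary

/-! ## Types up to combinators -/

/-- The `k`-fold sum of the unit type with itself. -/
def Ty.ofNat : ℕ → Ty
  | 0 => .zero
  | k + 1 => .sum .one (Ty.ofNat k)

theorem Ty.card_basis_ofNat : ∀ k, Fintype.card (Ty.ofNat k).Basis = k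
  | 0 => Fintype.card_eq_zero_iff.2 (inferInstanceAs (IsEmpty Empty))
  | k + 1 => by
    have h : Fintype.card (Ty.ofNat (k + 1)).Basis =
      Fintype.card (Unit ⊕ (Ty.ofNat k).Basis) := Fintype.card_congr (Equiv.refl _)
    rw [h, Fintype.card_sum, Ty.card_basis_ofNat k, Fintype.card_unit, add_comm]

/-- There are combinators between the two types in both directions. -/
def Ty.Conn (b b' : Ty) : Prop := Nonempty (Comb b b') ∧ Nonempty (Comb b' b)

namespace Ty.Conn

variable {a b c d : Ty}

theorem refl (b : Ty) : Conn b b := ⟨⟨.id b⟩, ⟨.id b⟩⟩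

theorem trans : Conn a b → Conn b c → Conn a c
  | ⟨⟨f⟩, ⟨f'⟩⟩, ⟨⟨g⟩, ⟨g'⟩⟩ => ⟨⟨.seq f g⟩, ⟨.seq g' f'⟩⟩

theorem sum : Conn a b → Conn c d → Conn (.sum a c) (.sum b d)
  | ⟨⟨f⟩, ⟨f'⟩⟩, ⟨⟨g⟩, ⟨g'⟩⟩ => ⟨⟨.sum f g⟩, ⟨.sum f' g'⟩⟩

theorem prod : Conn a b → Conn c d → Conn (.prod a c) (.prod b d)
  | ⟨⟨f⟩, ⟨f'⟩⟩, ⟨⟨g⟩, ⟨g'⟩⟩ => ⟨⟨.prod f g⟩, ⟨.prod f' g'⟩⟩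

theorem zero_sum (b : Ty) : Conn (.sum .zero b) b :=
  trans ⟨⟨.swapSum _ _⟩, ⟨.swapSum _ _⟩⟩ ⟨⟨.unitSum b⟩, ⟨.unitiSum b⟩⟩

/-- The value of `l` is left open here and below: when it matters, `Unitary.card_eq` determines it.
-/
theorem ofNat_sum_ofNat (j k : ℕ) : ∃ l, Conn (.sum (.ofNat j) (.ofNat k)) (.ofNat l) := by
  induction j with
  | zero => exact ⟨k, zero_sum _⟩
  | succ j ih =>
    obtain ⟨l, hl⟩ := ih
    exact ⟨l + 1, trans ⟨⟨.assocSum _ _ _⟩, ⟨.associSum _ _ _⟩⟩ ((refl .one).sum hl)⟩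

/-- Induction is on the right factor because `distrib`, `distribo` and `unitProd` act there. -/
theorem ofNat_prod_ofNat (j k : ℕ) : ∃ l, Conn (.prod (.ofNat j) (.ofNat k)) (.ofNat l) := by
  induction k with
  | zero => exact ⟨0, ⟨.distribo _⟩, ⟨.distriboi _⟩⟩
  | succ k ih =>
    obtain ⟨l, hl⟩ := ih
    obtain ⟨i, hi⟩ := ofNat_sum_ofNat j l
    refine ⟨i, trans ⟨⟨.distrib _ _ _⟩, ⟨.distribi _ _ _⟩⟩ (trans (sum ?_ hl) hi)⟩
    exact ⟨⟨.unitProd _⟩, ⟨.unitiProd _⟩⟩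

theorem exists_ofNat (b : Ty) : ∃ k, Conn b (.ofNat k) := by
  induction b with
  | zero => exact ⟨0, refl _⟩
  | one => exact ⟨1, ⟨.unitiSum _⟩, ⟨.unitSum _⟩⟩
  | sum a b iha ihb =>
    obtain ⟨j, hj⟩ := iha
    obtain ⟨k, hk⟩ := ihb
    obtain ⟨l, hl⟩ := ofNat_sum_ofNat j k
    exact ⟨l, (hj.sum hk).trans hl⟩
  | prod a b iha ihb =>
    obtain ⟨j, hj⟩ := iha
    obtain ⟨k, hk⟩ := ihb
    obtain ⟨l, hl⟩ := ofNat_prod_ofNat j k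
    exact ⟨l, (hj.prod hk).trans hl⟩

end Ty.Conn

/-! ## Preparation of vectors -/

theorem exists_circle_mul_norm (z : ℂ) : ∃ φ : Circle, (φ : ℂ) * (‖z‖ : ℂ) = z :=
  ⟨Circle.exp z.arg, by rw [Circle.coe_exp, mul_comm, Complex.norm_mul_exp_arg_mul_I]⟩

/-- Every vector of `ℂ²` is prepared by a combinator from a nonnegative multiple of the first basis
vector. -/
theorem exists_qbit_prepare (a b : ℂ) : ∃ (c : Comb Qbit Qbit) (r : ℝ), 0 ≤ r ∧
    c.sem.apply (Sum.elim (fun _ => (r : ℂ)) fun _ => 0) = Sum.elim (fun _ => a) fun _ => b := by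
  obtain ⟨α, hα⟩ := exists_circle_mul_norm a
  -- The circuit produces `i‖b‖` in the second coordinate before the last phases; the factor `-i`
  -- cancels this `i`.
  obtain ⟨β, hβ⟩ := exists_circle_mul_norm (-Complex.I * b)
  -- With `‖z‖φ = z` and `‖z‖ψ = z̄`, the product `H · diag(φ, ψ) · H` sends `(‖z‖, 0)` to `((z +
  -- z̄)/2, (z - z̄)/2) = (‖a‖, i‖b‖)`.
  set z : ℂ := ‖a‖ + ‖b‖ * Complex.I with hz
  obtain ⟨φ, hφ⟩ := exists_circle_mul_norm z
  obtain ⟨ψ, hψ⟩ := exists_circle_mul_norm ((starRingEnd ℂ) z)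
  have hs : (1 : ℂ) / ((√2 : ℝ) : ℂ) * (1 / ((√2 : ℝ) : ℂ)) = 1 / 2 := by
    rw [div_mul_div_comm, ← Complex.ofReal_mul, Real.mul_self_sqrt (by norm_num)]
    norm_num
  rw [Complex.norm_conj] at hψ
  have hcz : (starRingEnd ℂ) z = ‖a‖ - ‖b‖ * Complex.I := by
    simp [hz, sub_eq_add_neg]
  rw [hcz] at hψ
  rw [hz] at hφ
  have hβ' : (β : ℂ) * ‖b‖ * Complex.I = b := by
    have h1 : ‖-Complex.I * b‖ = ‖b‖ := by simp
    rw [h1] at hβ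
    rw [hβ]
    linear_combination -b * Complex.I_mul_I
  refine ⟨.seq (.seq .hadamard (.sum (.phase φ) (.phase ψ)))
    (.seq .hadamard (.sum (.phase α) (.phase β))), ‖z‖, norm_nonneg _, ?_⟩
  change ((((Unitary.phase α).dsum (Unitary.phase β)).comp Unitary.hadamard).comp
    (((Unitary.phase φ).dsum (Unitary.phase ψ)).comp Unitary.hadamard)).apply _ = _
  simp only [Unitary.comp_apply, Unitary.hadamard_apply, Unitary.dsum_apply, Unitary.phase_apply]
  congr 1 <;> funext _
  · linear_combination (α : ℂ) * (φ + ψ) * ‖z‖ * hs + (α : ℂ) / 2 * (hφ + hψ) + hα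
  · linear_combination (β : ℂ) * (φ - ψ) * ‖z‖ * hs + (β : ℂ) / 2 * (hφ - hψ) + hβ'

/-- Every vector of `ℂ^(k+1)` is prepared by a combinator from a nonnegative multiple of the first
basis vector. -/
theorem exists_prepare (k : ℕ) (a : ℂ) (w : (Ty.ofNat k).Basis → ℂ) :
    ∃ (c : Comb (.sum .one (.ofNat k)) (.sum .one (.ofNat k))) (r : ℝ), 0 ≤ r ∧
      c.sem.apply (Sum.elim (fun _ => (r : ℂ)) 0) = Sum.elim (fun _ => a) w := by
  induction k generalizing a with
  | zero =>
    obtain ⟨φ, hφ⟩ := exists_circle_mul_norm a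
    refine ⟨.sum (.phase φ) (.id _), ‖a‖, norm_nonneg a, ?_⟩
    simp only [Comb.sem]
    erw [Unitary.dsum_apply, Unitary.phase_apply, hφ]
    congr 1
    funext x
    exact Empty.elim x
  | succ k ih =>
    -- `c` prepares the tail `w` from `s e₁`, so it remains to prepare `(a, s)` in the first two
    -- coordinates. The sign of `s` is irrelevant.
    obtain ⟨c, s, -, hc⟩ := ih (w (Sum.inl ())) (w ∘ Sum.inr)
    obtain ⟨g, r, hr, hg⟩ := exists_qbit_prepare a s
    refine ⟨.seq (.seq (.associSum _ _ _) (.sum g (.id _)))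
      (.seq (.assocSum _ _ _) (.sum (.id _) c)), r, hr, ?_⟩
    have h0 : (0 : (Ty.ofNat (k + 1)).Basis → ℂ) = Sum.elim (fun _ : Unit => 0) 0 := by
      ext (_ | _) <;> rfl
    have hw : w = Sum.elim (fun _ : Unit => w (Sum.inl ())) (w ∘ Sum.inr) := by
      ext (_ | _) <;> rfl
    rw [h0, hw]
    exact Unitary.sumAssoc_conj_apply hg hc

/-! ## Universality -/

theorem exists_sem_eq_ofNat (k : ℕ) (U : Unitary (Ty.ofNat k).Basis (Ty.ofNat k).Basis) :
    ∃ c : Comb (.ofNat k) (.ofNat k), c.sem = U := by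
  induction k with
  | zero =>
    refine ⟨.id _, Unitary.ext ?_⟩
    ext x
    exact Empty.elim x
  | succ k ih =>
    obtain ⟨c, r, hr, hc⟩ := exists_prepare k (U.mat (Sum.inl ()) (Sum.inl ()))
      fun x => U.mat (Sum.inr x) (Sum.inl ())
    change Unitary (Unit ⊕ (Ty.ofNat k).Basis) (Unit ⊕ (Ty.ofNat k).Basis) at U
    -- If `C` sends `r e₁` to the first column of `U`, then `C† U` sends `e₁` to `r e₁` and
    -- therefore splits as `1 ⊕ g`.
    have key : ∀ C : Unitary (Unit ⊕ (Ty.ofNat k).Basis) (Unit ⊕ (Ty.ofNat k).Basis),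
        C.apply (Sum.elim (fun _ => (r : ℂ)) 0) = (fun x => U.mat x (Sum.inl ())) →
        ∃ g, U = C.comp ((Unitary.id Unit).dsum g) := by
      intro C hC
      obtain ⟨g, hg⟩ := (C.adjoint.comp U).exists_eq_dsum r hr (by
        intro x
        have h1 : (C.adjoint.comp U).mat x (Sum.inl ()) =
            C.adjoint.apply (fun x => U.mat x (Sum.inl ())) x := rfl
        rw [h1, ← hC, ← Unitary.comp_apply, Unitary.adjoint_comp, Unitary.id_apply]
        rcases x with x | x <;> simp)
      exact ⟨g, by rw [← hg, Unitary.comp_adjoint_comp]⟩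
    obtain ⟨g, hg⟩ := key c.sem (hc.trans (by ext (_ | _) <;> rfl))
    obtain ⟨d, hd⟩ := ih g
    refine ⟨.seq (.sum (.id .one) d) c, ?_⟩
    rw [hg, ← hd]
    rfl

/-- Every unitary between the interpretations of two types is denoted by a combinator. -/
theorem exists_sem_eq {a b : Ty} (U : Unitary a.Basis b.Basis) : ∃ c : Comb a b, c.sem = U := by
  obtain ⟨j, ⟨f⟩, -⟩ := Ty.Conn.exists_ofNat a
  obtain ⟨k, -, ⟨g⟩⟩ := Ty.Conn.exists_ofNat b
  obtain rfl : j = k := by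
    rw [← Ty.card_basis_ofNat j, ← Ty.card_basis_ofNat k, ← f.sem.card_eq, U.card_eq,
      g.sem.card_eq]
  -- `f` and `g` may denote any unitaries: `c` is chosen to undo both, so no coherence of the type
  -- conversions is needed.
  obtain ⟨c, hc⟩ := exists_sem_eq_ofNat j (g.sem.adjoint.comp (U.comp f.sem.adjoint))
  refine ⟨.seq f (.seq c g), ?_⟩
  simp only [Comb.sem, hc]
  rw [Unitary.comp_adjoint_comp, Unitary.comp_comp_adjoint]

/-! ### Isometries as restrictions of unitaries -/

section

variable {A B H : Type} [Fintype A] [DecidableEq A] [Fintype B] [DecidableEq B]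
  [Fintype H] [DecidableEq H]

/-- The identity of `ℂ^A` factors through `ℂ^B`, which bounds its rank. -/
theorem Isom.card_le (V : Isom A B) : Fintype.card A ≤ Fintype.card B := by
  have h := Matrix.rank_mul_le_right V.matᴴ V.mat
  rw [V.star_mul, Matrix.rank_one] at h
  exact h.trans (Matrix.rank_le_card_height _)

/-- An isometry extends to a unitary. -/
theorem Isom.exists_unitary (V : Isom A B)
    (hcard : Fintype.card A + Fintype.card H = Fintype.card B) :
    ∃ U : Unitary (A ⊕ H) B, U.toIsom.comp (Isom.inl A H) = V := by
  -- The zero vectors on `H` are placeholders: only the columns of `V` must be orthonormal, and the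
  -- basis extension replaces the rest.
  let v : A ⊕ H → EuclideanSpace ℂ B :=
    Sum.elim (fun a => WithLp.toLp 2 fun b => V.mat b a) 0
  have hv : Orthonormal ℂ ((Set.range Sum.inl).domRestrict v) := by
    rw [orthonormal_iff_ite]
    rintro ⟨_, i, rfl⟩ ⟨_, j, rfl⟩
    have h := congrFun (congrFun V.star_mul i) j
    simp only [Matrix.mul_apply, Matrix.conjTranspose_apply, Matrix.one_apply] at h
    simp [v, PiLp.inner_apply, Set.domRestrict_apply, Subtype.ext_iff, ← h, mul_comm]
  obtain ⟨e, he⟩ := hv.exists_orthonormalBasis_extension_of_card_eq (by simp [hcard])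
  let M : Matrix B (A ⊕ H) ℂ := Matrix.of fun b x => e x b
  have hM : Mᴴ * M = 1 := by
    ext x y
    have h := orthonormal_iff_ite.1 e.orthonormal x y
    simp only [PiLp.inner_apply, RCLike.inner_apply] at h
    simp only [Matrix.mul_apply, Matrix.conjTranspose_apply, Matrix.one_apply, ← h]
    exact Finset.sum_congr rfl fun b _ => mul_comm _ _
  refine ⟨⟨M, hM, ?_⟩, ?_⟩
  -- By equality of dimensions, a one-sided inverse is two-sided.
  · exact (Matrix.mul_eq_one_comm_of_card_eq _ _ _ (by simp [hcard])).1 hM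
  · ext b a
    have h := he (Sum.inl a) ⟨a, rfl⟩
    have h' : e (Sum.inl a) b = V.mat b a := by rw [h]; rfl
    simp [Isom.comp, Isom.inl, Unitary.toIsom, M, Matrix.mul_apply, Matrix.one_apply, h']

end

/-- Every isometry between the interpretations of two types is denoted by a combinator with a
heap. -/
theorem exists_toIsom_sem_eq {a b : Ty} (V : Isom a.Basis b.Basis) :
    ∃ v : CombA a b, v.sem.toIsom = V := by
  -- The heap has the complementary dimension; by `Isom.card_le` the subtraction does not truncate.
  obtain ⟨U, hU⟩ := V.exists_unitary
    (H := (Ty.ofNat (Fintype.card b.Basis - Fintype.card a.Basis)).Basis) (by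
      rw [Ty.card_basis_ofNat, Nat.add_sub_of_le V.card_le])
  obtain ⟨c, hc⟩ := exists_sem_eq (a := .sum a (.ofNat _)) U
  refine ⟨.lift c, ?_⟩
  rw [← hU, ← hc]
  rfl

end UPi

theorem theorem2 (m n : ℕ) (V : Matrix (Fin (2 ^ n)) (Fin (2 ^ m)) ℂ) (hV : Vᴴ * V = 1)
    (δ : ℝ) (hδ : 0 < δ) :
    ∃ v : UPi.CombA (UPi.qbits m) (UPi.qbits n), ‖V - v.matrix‖ < δ := by
  obtain ⟨v, hv⟩ := UPi.exists_toIsom_sem_eq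
    (a := UPi.qbits m) (b := UPi.qbits n)
    ⟨V.submatrix (UPi.qbitsEnum n) (UPi.qbitsEnum m), by
      rw [Matrix.conjTranspose_submatrix, Matrix.submatrix_mul_equiv, hV,
        Matrix.submatrix_one_equiv]⟩
  refine ⟨v, ?_⟩
  -- The two reindexings along `qbitsEnum` cancel, so the distance is zero.
  have h : v.matrix = V := by
    simp [UPi.CombA.matrix, hv]
  simpa [h] using hδ
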